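/- Let $d \ge 2$. There is a constant $c > 0$, depending only on $d$, such that the following holds. Let $q$ be a random vector in $\mathbb{R}^d$ whose distribution is spherically symmetric (invariant under all orthogonal transformations), let $\omega : \mathbb{R} \to [0,\infty)$ be any measurable weight function, let $u \in \mathbb{R}^d\setminus\{0\}$ and $\tilde u \in \mathbb{R}^d$. Put $$\ell(u,\tilde u,\omega) = \mathbb{E}_q\big[\omega(\langle q,u\rangle)\,\langle q,u-\tilde u\rangle^2\big],\qquad r_\parallel = \frac{\langle u-\tilde u,u\rangle}{\|u\|^2}\,u,\qquad r_\perp = (u-\tilde u)-r_\parallel,$$ and, for $t \ge 0$, $$h_\parallel(\omega,t) = \int_0^\pi \omega(t\cos\theta)\,\big(\sin^{d-2}\theta-\sin^d\theta\big)\,d\theta,\qquad h_\perp(\omega,t) = \frac{1}{d-1}\int_0^\pi \omega(t\cos\theta)\,\sin^d\theta\,d\theta .$$ (All expectations and integrals are of nonnegative functions and take values in $[0,\infty]$, with $0\cdot\infty = 0$.) If $\|q\| = 1$ almost surely, then $$\ell(u,\tilde u,\omega) = c\,\Big(h_\parallel(\omega,\|u\|)\,\|r_\parallel\|^2 + h_\perp(\omega,\|u\|)\,\|r_\perp\|^2\Big).$$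 Without any assumption on the norm of $q$, $$\ell(u,\tilde u,\omega) = c\,\Big(\mathbb{E}_q\big[\|q\|^2\, h_\parallel(\omega,\|q\|\,\|u\|)\big]\,\|r_\parallel\|^2 + \mathbb{E}_q\big[\|q\|^2\, h_\perp(\omega,\|q\|\,\|u\|)\big]\,\|r_\perp\|^2\Big).$$ -/

import Mathlib

open MeasureTheory
open scoped NNReal ENNReal

noncomputable section

/-- A measure on `ℝ^d` is spherically symmetric if it is invariant under every
orthogonal transformation (linear isometric automorphism) of `ℝ^d`. -/
def SphericallySymmetric {d : ℕ} (μ : Measure (EuclideanSpace ℝ (Fin d))) : Prop :=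
  ∀ U : EuclideanSpace ℝ (Fin d) ≃ₗᵢ[ℝ] EuclideanSpace ℝ (Fin d), μ.map U = μ

/-- The score-aware loss `E_q[ω(⟨q, u⟩) ⟨q, u - v⟩²]`, where `q` has law `μ` and `v` is the
approximation of `u`: the expectation of a nonnegative random variable, with values in `[0, ∞]`. -/
def scoreAwareLoss {d : ℕ} (μ : Measure (EuclideanSpace ℝ (Fin d))) (ω : ℝ → ℝ≥0)
    (u v : EuclideanSpace ℝ (Fin d)) : ℝ≥0∞ :=
  ∫⁻ q, (ω (inner ℝ q u) : ℝ≥0∞) * ENNReal.ofReal ((inner ℝ q (u - v)) ^ 2) ∂μ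

/-- The component of the residual `u - v` parallel to `u`. -/
def residualParallel {d : ℕ} (u v : EuclideanSpace ℝ (Fin d)) : EuclideanSpace ℝ (Fin d) :=
  (inner ℝ (u - v) u / ‖u‖ ^ 2) • u

/-- The component of the residual `u - v` orthogonal to `u`. -/
def residualOrthogonal {d : ℕ} (u v : EuclideanSpace ℝ (Fin d)) : EuclideanSpace ℝ (Fin d) :=
  (u - v) - residualParallel u v

/-- `∫_0^π ω(t cos θ) (sin^{d-2} θ - sin^d θ) dθ`, with values in `[0, ∞]`, for `d ≥ 2`
(the trigonometric factor is nonnegative on `[0, π]`). -/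
def hParallel (d : ℕ) (ω : ℝ → ℝ≥0) (t : ℝ) : ℝ≥0∞ :=
  ∫⁻ θ in Set.Icc 0 Real.pi,
    (ω (t * Real.cos θ) : ℝ≥0∞) * ENNReal.ofReal (Real.sin θ ^ (d - 2) - Real.sin θ ^ d)

/-- `(1 / (d - 1)) ∫_0^π ω(t cos θ) sin^d θ dθ`, with values in `[0, ∞]`, for `d ≥ 2`. -/
def hOrthogonal (d : ℕ) (ω : ℝ → ℝ≥0) (t : ℝ) : ℝ≥0∞ :=
  ENNReal.ofReal (1 / ((d : ℝ) - 1)) *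
    ∫⁻ θ in Set.Icc 0 Real.pi,
      (ω (t * Real.cos θ) : ℝ≥0∞) * ENNReal.ofReal (Real.sin θ ^ d)

end

/-! Split `u - v` into its components along and orthogonal to `u`. Reflecting the orthogonal
component preserves the law and `⟨q, u⟩`, so the cross term vanishes; the same symmetry makes all
orthogonal directions contribute equally, each a `1 / (d - 1)` share of `‖q‖² - ⟨q, e⟩²`, with `e =
u / ‖u‖`. Both terms then depend only on `‖q‖` and `⟨q, e⟩`. By `exists_lintegral_norm_inner`, `⟨q,
e⟩` may be replaced by `‖q‖ cos θ` with `θ` of density `c sin^(d-2) θ`. The factors `cos² θ` and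
`sin² θ` turn this density into the weights of `hParallel` and `hOrthogonal`. -/

/-- Integration of a radial function in polar coordinates. -/
theorem lintegral_fun_norm_addHaar {E : Type*} [NormedAddCommGroup E] [NormedSpace ℝ E]
    [MeasurableSpace E] [BorelSpace E] [FiniteDimensional ℝ E] [Nontrivial E]
    (μ : Measure E) [μ.IsAddHaarMeasure] {f : ℝ → ℝ≥0∞} (hf : Measurable f) :
    ∫⁻ x, f ‖x‖ ∂μ = Module.finrank ℝ E * μ (Metric.ball 0 1) *
      ∫⁻ y in Set.Ioi (0 : ℝ), ENNReal.ofReal (y ^ (Module.finrank ℝ E - 1)) * f y :=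
  calc
    ∫⁻ x, f ‖x‖ ∂μ = ∫⁻ x : ({(0)}ᶜ : Set E), f ‖x.1‖ ∂(μ.comap (↑)) := by
      rw [lintegral_subtype_comap (measurableSet_singleton _).compl fun x ↦ f ‖x‖,
        restrict_compl_singleton]
    _ = ∫⁻ x, f x.2 ∂μ.toSphere.prod (.volumeIoiPow (Module.finrank ℝ E - 1)) := by
      simpa using μ.measurePreserving_homeomorphUnitSphereProd.lintegral_comp_emb
        (Homeomorph.measurableEmbedding _) (f ∘ Subtype.val ∘ Prod.snd)
    _ = μ.toSphere Set.univ *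
        ∫⁻ x : Set.Ioi (0 : ℝ), f x ∂.volumeIoiPow (Module.finrank ℝ E - 1) := by
      rw [lintegral_prod _ (by fun_prop)]
      simp only [lintegral_const, mul_comm]
    _ = _ := by
      rw [μ.toSphere_apply_univ, Measure.volumeIoiPow,
        lintegral_withDensity_eq_lintegral_mul _ (by fun_prop) (by fun_prop),
        ← lintegral_subtype_comap measurableSet_Ioi]
      rfl

/-- Integration over `ℝ^(n+2)` of a function of the first coordinate and the norm, in terms of the
first coordinate and the norm of the remaining ones. -/
theorem lintegral_coord_norm (n : ℕ) {g : ℝ × ℝ → ℝ≥0∞} (hg : Measurable g) :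
    ∫⁻ x : EuclideanSpace ℝ (Fin (n + 2)), g (x 0, ‖x‖) =
      (n + 1 : ℕ) * volume (Metric.ball (0 : EuclideanSpace ℝ (Fin (n + 1))) 1) *
        ∫⁻ x : ℝ, ∫⁻ s in Set.Ioi (0 : ℝ),
          ENNReal.ofReal (s ^ n) * g (x, √(x ^ 2 + s ^ 2)) := by
  have hnorm (x : ℝ) (y : Fin (n + 1) → ℝ) :
      ‖(WithLp.toLp 2 (Fin.cons x y : Fin (n + 2) → ℝ) : EuclideanSpace ℝ (Fin (n + 2)))‖ =
        √(x ^ 2 + ‖(WithLp.toLp 2 y : EuclideanSpace ℝ (Fin (n + 1)))‖ ^ 2) := by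
    rw [EuclideanSpace.norm_eq, EuclideanSpace.norm_sq_eq, Fin.sum_univ_succ]
    simp
  calc
    _ = ∫⁻ x : Fin (n + 2) → ℝ, g (x 0, ‖(WithLp.toLp 2 x : EuclideanSpace ℝ (Fin (n + 2)))‖) :=
      ((PiLp.volume_preserving_toLp (Fin (n + 2))).lintegral_comp_emb
        (MeasurableEquiv.toLp 2 _).measurableEmbedding _).symm
    _ = ∫⁻ p : ℝ × (Fin (n + 1) → ℝ),
        g (p.1, √(p.1 ^ 2 + ‖(WithLp.toLp 2 p.2 : EuclideanSpace ℝ (Fin (n + 1)))‖ ^ 2)) := by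
      rw [← ((volume_preserving_piFinSuccAbove (fun _ : Fin (n + 2) => ℝ) 0).symm).lintegral_comp_emb
        (MeasurableEquiv.measurableEmbedding _)]
      refine lintegral_congr fun p => ?_
      rw [← hnorm]
      simp [MeasurableEquiv.piFinSuccAbove, Fin.insertNthEquiv]
    _ = ∫⁻ x : ℝ, ∫⁻ y : Fin (n + 1) → ℝ,
        g (x, √(x ^ 2 + ‖(WithLp.toLp 2 y : EuclideanSpace ℝ (Fin (n + 1)))‖ ^ 2)) := by
      rw [Measure.volume_eq_prod, lintegral_prod _ (by fun_prop)]
    _ = ∫⁻ x : ℝ, ∫⁻ y : EuclideanSpace ℝ (Fin (n + 1)), g (x, √(x ^ 2 + ‖y‖ ^ 2)) :=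
      lintegral_congr fun x => (PiLp.volume_preserving_toLp (Fin (n + 1))).lintegral_comp_emb
        (MeasurableEquiv.toLp 2 _).measurableEmbedding fun y => g (x, √(x ^ 2 + ‖y‖ ^ 2))
    _ = _ := by
      rw [← lintegral_const_mul' _ _ (by finiteness)]
      refine lintegral_congr fun x => ?_
      rw [lintegral_fun_norm_addHaar volume (f := fun s => g (x, √(x ^ 2 + s ^ 2))) (by fun_prop)]
      simp

/-- Polar coordinates on the upper half-plane. -/
theorem lintegral_halfPlane_polar (n : ℕ) {g : ℝ × ℝ → ℝ≥0∞} (hg : Measurable g) :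
    ∫⁻ x : ℝ, ∫⁻ s in Set.Ioi (0 : ℝ), ENNReal.ofReal (s ^ n) * g (x, √(x ^ 2 + s ^ 2)) =
      ∫⁻ r in Set.Ioi (0 : ℝ), ∫⁻ θ in Set.Icc 0 Real.pi,
        ENNReal.ofReal (r ^ (n + 1)) *
          (g (r * Real.cos θ, r) * ENNReal.ofReal (Real.sin θ ^ n)) := by
  -- Extension by zero to the whole plane; angles in the lower half-plane then contribute nothing.
  set F : ℝ × ℝ → ℝ≥0∞ := fun p => (Set.Ioi (0 : ℝ)).indicator
    (fun s => ENNReal.ofReal (s ^ n) * g (p.1, √(p.1 ^ 2 + s ^ 2))) p.2 with hF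
  have hFm : Measurable F := by
    have : F = (Prod.snd ⁻¹' Set.Ioi (0 : ℝ)).indicator
        fun p : ℝ × ℝ => ENNReal.ofReal (p.2 ^ n) * g (p.1, √(p.1 ^ 2 + p.2 ^ 2)) := rfl
    rw [this]
    exact Measurable.indicator (by fun_prop) (measurable_snd measurableSet_Ioi)
  calc
    _ = ∫⁻ x : ℝ, ∫⁻ s : ℝ, F (x, s) :=
      lintegral_congr fun x => (lintegral_indicator measurableSet_Ioi _).symm
    _ = ∫⁻ p : ℝ × ℝ, F p := by
      rw [Measure.volume_eq_prod, lintegral_prod _ hFm.aemeasurable]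
    _ = ∫⁻ r in Set.Ioi (0 : ℝ), ∫⁻ θ in Set.Ioo (-Real.pi) Real.pi,
        ENNReal.ofReal r * F (r * Real.cos θ, r * Real.sin θ) := by
      rw [← lintegral_comp_polarCoord_symm, polarCoord_target, Measure.volume_eq_prod,
        ← Measure.prod_restrict, lintegral_prod]
      · simp
      · simp only [polarCoord_symm_apply, smul_eq_mul]
        fun_prop
    _ = _ := by
      refine setLIntegral_congr_fun measurableSet_Ioi fun r (hr : 0 < r) => ?_
      rw [setLIntegral_congr Ioo_ae_eq_Icc.symm, ← lintegral_indicator measurableSet_Ioo,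
        ← lintegral_indicator measurableSet_Ioo]
      refine lintegral_congr fun θ => ?_
      by_cases h : θ ∈ Set.Ioo 0 Real.pi
      · have h' : θ ∈ Set.Ioo (-Real.pi) Real.pi := ⟨by linarith [h.1, h.2], h.2⟩
        have hs : 0 < Real.sin θ := Real.sin_pos_of_mem_Ioo h
        have hrs : r * Real.sin θ ∈ Set.Ioi (0 : ℝ) := mul_pos hr hs
        rw [Set.indicator_of_mem h, Set.indicator_of_mem h', hF]
        simp only [Set.indicator_of_mem hrs]
        rw [show (r * Real.cos θ) ^ 2 + (r * Real.sin θ) ^ 2 = r ^ 2 by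
          rw [mul_pow, mul_pow, ← mul_add, Real.cos_sq_add_sin_sq, mul_one], Real.sqrt_sq hr.le,
          mul_pow, ENNReal.ofReal_mul (by positivity), pow_succ', ENNReal.ofReal_mul hr.le]
        ring
      · rw [Set.indicator_of_notMem h]
        by_cases h' : θ ∈ Set.Ioo (-Real.pi) Real.pi
        · have hs : Real.sin θ ≤ 0 :=
            Real.sin_nonpos_of_nonpos_of_neg_pi_le
              (not_lt.1 fun h0 => h ⟨h0, h'.2⟩) h'.1.le
          have hrs : r * Real.sin θ ∉ Set.Ioi (0 : ℝ) :=
            not_lt.2 (mul_nonpos_of_nonneg_of_nonpos hr.le hs)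
          rw [Set.indicator_of_mem h', hF]
          simp only [Set.indicator_of_notMem hrs, mul_zero]
        · rw [Set.indicator_of_notMem h']

/-- On the unit ball, the cosine of the angle to the first axis has density proportional to
`sin ^ n` in the angle. -/
theorem exists_lintegral_ball_angle (n : ℕ) :
    ∃ C : ℝ≥0∞, ∀ ψ : ℝ → ℝ≥0∞, Measurable ψ →
      ∫⁻ x in Metric.ball (0 : EuclideanSpace ℝ (Fin (n + 2))) 1, ψ (x 0 / ‖x‖) =
        C * ∫⁻ θ in Set.Icc 0 Real.pi, ψ (Real.cos θ) * ENNReal.ofReal (Real.sin θ ^ n) := by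
  -- The area of the unit `n`-sphere times `∫_0^1 r^(n+1) dr`: the radius separates because `x 0 /
  -- ‖x‖` does not depend on it.
  refine ⟨(n + 1 : ℕ) * volume (Metric.ball (0 : EuclideanSpace ℝ (Fin (n + 1))) 1) *
    ∫⁻ r in Set.Ioi (0 : ℝ), ENNReal.ofReal (r ^ (n + 1)) * (Set.Iio (1 : ℝ)).indicator 1 r,
    fun ψ hψ => ?_⟩
  have hm : Measurable ((Set.Iio (1 : ℝ)).indicator (1 : ℝ → ℝ≥0∞)) :=
    measurable_one.indicator measurableSet_Iio
  have hg : Measurable fun p : ℝ × ℝ =>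
      (Set.Iio (1 : ℝ)).indicator 1 p.2 * ψ (p.1 / p.2) := by fun_prop
  calc
    _ = ∫⁻ x : EuclideanSpace ℝ (Fin (n + 2)),
        (Set.Iio (1 : ℝ)).indicator 1 ‖x‖ * ψ (x 0 / ‖x‖) := by
      rw [← lintegral_indicator measurableSet_ball]
      refine lintegral_congr fun x => ?_
      by_cases h : ‖x‖ < 1 <;> simp [Set.indicator, h]
    _ = _ := by
      rw [lintegral_coord_norm n hg, lintegral_halfPlane_polar n hg, mul_assoc (_ * _),
        ← lintegral_mul_const _ (by fun_prop)]
      congr 1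
      refine setLIntegral_congr_fun measurableSet_Ioi fun r (hr : 0 < r) => ?_
      simp only [mul_div_cancel_left₀ _ hr.ne']
      rw [← lintegral_const_mul _ (by fun_prop)]
      simp only [mul_assoc]

/-! ### Reflections and spherically symmetric laws -/

open scoped RealInnerProductSpace in
/-- Two vectors of the same norm are exchanged by a linear isometry which fixes every vector
having the same inner product with both. -/
theorem exists_linearIsometryEquiv_map_eq {E : Type*} [NormedAddCommGroup E]
    [InnerProductSpace ℝ E] {v w : E} (h : ‖v‖ = ‖w‖) :
    ∃ U : E ≃ₗᵢ[ℝ] E, U v = w ∧ ∀ x, ⟪x, v⟫ = ⟪x, w⟫ → U x = x := by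
  refine ⟨(ℝ ∙ (v - w))ᗮ.reflection, Submodule.reflection_sub h, fun x hx => ?_⟩
  refine Submodule.reflection_mem_subspace_eq_self ?_
  rw [Submodule.mem_orthogonal_singleton_iff_inner_left, inner_sub_right, hx, sub_self]

theorem SphericallySymmetric.lintegral_comp {d : ℕ} {μ : Measure (EuclideanSpace ℝ (Fin d))}
    (hμ : SphericallySymmetric μ) (U : EuclideanSpace ℝ (Fin d) ≃ₗᵢ[ℝ] EuclideanSpace ℝ (Fin d))
    (f : EuclideanSpace ℝ (Fin d) → ℝ≥0∞) : ∫⁻ q, f (U q) ∂μ = ∫⁻ q, f q ∂μ := by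
  have h := lintegral_map_equiv (μ := μ) f U.toMeasurableEquiv
  rw [LinearIsometryEquiv.coe_toMeasurableEquiv, hμ U] at h
  exact h.symm

theorem sphericallySymmetric_volume_ball (d : ℕ) (r : ℝ) :
    SphericallySymmetric
      ((volume : Measure (EuclideanSpace ℝ (Fin d))).restrict (Metric.ball 0 r)) := by
  intro U
  have h := (U.measurePreserving.restrict_preimage
    (measurableSet_ball (x := (0 : EuclideanSpace ℝ (Fin d))) (ε := r))).map_eq
  rwa [show U ⁻¹' Metric.ball 0 r = Metric.ball 0 r by simp [U.preimage_ball]] at h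

/-- Disintegration of a spherically symmetric law along one axis: the norm is kept, and the angle
to the axis has density proportional to `sin ^ n`, independently of the norm. -/
theorem exists_lintegral_norm_inner (n : ℕ) :
    ∃ c : ℝ≥0, 0 < c ∧ ∀ μ : Measure (EuclideanSpace ℝ (Fin (n + 2))), SFinite μ →
      SphericallySymmetric μ → ∀ φ : ℝ × ℝ → ℝ≥0∞, Measurable φ →
      ∀ e : EuclideanSpace ℝ (Fin (n + 2)), ‖e‖ = 1 →
        ∫⁻ q, φ (‖q‖, inner ℝ q e) ∂μ =
          c * ∫⁻ q, (∫⁻ θ in Set.Icc 0 Real.pi,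
            φ (‖q‖, ‖q‖ * Real.cos θ) * ENNReal.ofReal (Real.sin θ ^ n)) ∂μ := by
  obtain ⟨C, hC⟩ := exists_lintegral_ball_angle n
  set ν := (volume : Measure (EuclideanSpace ℝ (Fin (n + 2)))).restrict (Metric.ball 0 1) with hν
  have hνs : SphericallySymmetric ν := sphericallySymmetric_volume_ball _ _
  set V := volume (Metric.ball (0 : EuclideanSpace ℝ (Fin (n + 2))) 1) with hV
  have hV0 : V ≠ 0 := (Metric.measure_ball_pos _ _ one_pos).ne'
  have hVt : V ≠ ∞ := measure_ball_lt_top.ne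
  set S := ∫⁻ θ in Set.Icc 0 Real.pi, ENNReal.ofReal (Real.sin θ ^ n) with hS
  -- Testing on the constant 1 forces `0 < C < ∞`, and shows that `C / V` is `1 / ∫ sin^n`.
  have hVS : V = C * S := by
    simpa [hν, hV, hS] using hC (fun _ => 1) measurable_const
  have hC0 : C ≠ 0 := by rintro rfl; exact hV0 (by simpa using hVS)
  have hS0 : S ≠ 0 := by rintro h; exact hV0 (by simpa [h] using hVS)
  have hCt : C ≠ ∞ := by
    rintro rfl
    rw [ENNReal.top_mul hS0] at hVS
    exact hVt hVS
  have hct : C / V ≠ ∞ := ENNReal.div_ne_top hCt hV0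
  refine ⟨(C / V).toNNReal, ENNReal.toNNReal_pos (ENNReal.div_ne_zero.2 ⟨hC0, hVt⟩) hct,
    fun μ _ hμ φ hφ e he => ?_⟩
  rw [ENNReal.coe_toNNReal hct]
  have hunit (e' : EuclideanSpace ℝ (Fin (n + 2))) (he' : ‖e'‖ = 1) :
      ∫⁻ q, φ (‖q‖, inner ℝ q e') ∂μ = ∫⁻ q, φ (‖q‖, inner ℝ q e) ∂μ := by
    obtain ⟨U, hU, -⟩ := exists_linearIsometryEquiv_map_eq (he.trans he'.symm)
    rw [← hμ.lintegral_comp U]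
    simp [← hU]
  have hnu (q : EuclideanSpace ℝ (Fin (n + 2))) :
      ∫⁻ x, φ (‖q‖, inner ℝ q (‖x‖⁻¹ • x)) ∂ν =
        C * ∫⁻ θ in Set.Icc 0 Real.pi,
          φ (‖q‖, ‖q‖ * Real.cos θ) * ENNReal.ofReal (Real.sin θ ^ n) := by
    have hnorm : ‖‖q‖ • (EuclideanSpace.single 0 1 : EuclideanSpace ℝ (Fin (n + 2)))‖ = ‖q‖ := by
      simp [norm_smul]
    -- Symmetry of `ν` allows `q` to be moved onto the first axis, where `hC` applies.
    obtain ⟨U, hU, -⟩ := exists_linearIsometryEquiv_map_eq hnorm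
    rw [← hνs.lintegral_comp U, ← hC (fun t => φ (‖q‖, ‖q‖ * t)) (by fun_prop)]
    refine lintegral_congr fun x => ?_
    conv_lhs => rw [← hU]
    simp only [U.norm_map, hnorm, ← map_smul, U.inner_map_map]
    simp [real_inner_smul_left, real_inner_smul_right, EuclideanSpace.inner_single_left,
      div_eq_inv_mul, mul_left_comm]
  have key : V * ∫⁻ q, φ (‖q‖, inner ℝ q e) ∂μ =
      C * ∫⁻ q, (∫⁻ θ in Set.Icc 0 Real.pi,
        φ (‖q‖, ‖q‖ * Real.cos θ) * ENNReal.ofReal (Real.sin θ ^ n)) ∂μ := by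
    -- The integral is the same for every unit vector, so `e` is averaged over the directions `x /
    -- ‖x‖` of the ball. After Tonelli, `q` is fixed and the direction is random.
    calc
      _ = ∫⁻ x, ∫⁻ q, φ (‖q‖, inner ℝ q e) ∂μ ∂ν := by
        rw [lintegral_const, hν, Measure.restrict_apply_univ, mul_comm]
      _ = ∫⁻ x, ∫⁻ q, φ (‖q‖, inner ℝ q (‖x‖⁻¹ • x)) ∂μ ∂ν := by
        have h0 : ∀ᵐ x ∂ν, x ≠ 0 := ae_restrict_of_ae (Measure.ae_ne volume 0)
        refine lintegral_congr_ae (h0.mono fun x hx => (hunit _ ?_).symm)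
        simp [norm_smul, hx]
      _ = ∫⁻ q, ∫⁻ x, φ (‖q‖, inner ℝ q (‖x‖⁻¹ • x)) ∂ν ∂μ :=
        lintegral_lintegral_swap (by unfold Function.uncurry; fun_prop)
      _ = _ := by
        simp_rw [hnu]
        rw [lintegral_const_mul' _ _ hCt]
  rw [div_eq_mul_inv, mul_right_comm, ← key, mul_right_comm, ENNReal.mul_inv_cancel hV0 hVt,
    one_mul]

/-! ### Parallel and orthogonal contributions -/

section Components

variable {d : ℕ} {μ : Measure (EuclideanSpace ℝ (Fin d))} {ω : ℝ → ℝ≥0}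

/-- Under a spherically symmetric law the cross term between a component along `u` and a component
orthogonal to `u` vanishes. -/
theorem SphericallySymmetric.lintegral_inner_add_sq (hμ : SphericallySymmetric μ)
    (hω : Measurable ω) {u w : EuclideanSpace ℝ (Fin d)} (huw : inner ℝ u w = 0) (a : ℝ) :
    ∫⁻ q, (ω (inner ℝ q u) : ℝ≥0∞) * ENNReal.ofReal ((inner ℝ q (a • u + w)) ^ 2) ∂μ =
      ∫⁻ q, (ω (inner ℝ q u) : ℝ≥0∞) * ENNReal.ofReal ((inner ℝ q (a • u)) ^ 2) ∂μ +
      ∫⁻ q, (ω (inner ℝ q u) : ℝ≥0∞) * ENNReal.ofReal ((inner ℝ q w) ^ 2) ∂μ := by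
  obtain ⟨U, hUw, hU⟩ := exists_linearIsometryEquiv_map_eq (v := w) (w := -w) (by simp)
  have hUu : U u = u := hU u (by simp [huw])
  set L := ∫⁻ q, (ω (inner ℝ q u) : ℝ≥0∞) * ENNReal.ofReal ((inner ℝ q (a • u + w)) ^ 2) ∂μ with hL
  have hrefl : L =
      ∫⁻ q, (ω (inner ℝ q u) : ℝ≥0∞) * ENNReal.ofReal ((inner ℝ q (a • u - w)) ^ 2) ∂μ := by
    rw [← hμ.lintegral_comp U]
    refine lintegral_congr fun q => ?_
    have h1 : inner ℝ (U q) u = inner ℝ q u := by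
      conv_lhs => rw [← hUu, U.inner_map_map]
    have h2 : inner ℝ (U q) (a • u - w) = inner ℝ q (a • u + w) := by
      rw [show a • u - w = U (a • u + w) by rw [map_add, map_smul, hUu, hUw, sub_eq_add_neg],
        U.inner_map_map]
    rw [h1, h2]
  have hofReal (t : ℝ) : 2 * ENNReal.ofReal t = ENNReal.ofReal (2 * t) := by
    rw [ENNReal.ofReal_mul zero_le_two, ENNReal.ofReal_ofNat]
  -- Adding the two forms of `L` cancels the cross term pointwise, so a signed, possibly
  -- non-integrable term is never integrated.
  have h2 : 2 * L = 2 *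
      (∫⁻ q, (ω (inner ℝ q u) : ℝ≥0∞) * ENNReal.ofReal ((inner ℝ q (a • u)) ^ 2) ∂μ +
      ∫⁻ q, (ω (inner ℝ q u) : ℝ≥0∞) * ENNReal.ofReal ((inner ℝ q w) ^ 2) ∂μ) := by
    rw [two_mul]
    nth_rw 2 [hrefl]
    rw [hL, ← lintegral_add_left (by fun_prop), ← lintegral_add_left (by fun_prop),
      ← lintegral_const_mul _ (by fun_prop)]
    refine lintegral_congr fun q => ?_
    rw [← mul_add, ← mul_add, ← ENNReal.ofReal_add (by positivity) (by positivity),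
      ← ENNReal.ofReal_add (by positivity) (by positivity), mul_left_comm,
      hofReal, inner_add_right, inner_sub_right]
    congr 2
    ring
  exact (ENNReal.mul_right_inj two_ne_zero ENNReal.ofNat_ne_top).1 h2

/-- Under a spherically symmetric law all directions orthogonal to `e` contribute equally. -/
theorem SphericallySymmetric.lintegral_inner_orthogonal_sq (hμ : SphericallySymmetric μ)
    (hd : 2 ≤ d) {g : ℝ → ℝ≥0∞} (hg : Measurable g)
    {e w : EuclideanSpace ℝ (Fin d)} (he : ‖e‖ = 1) (hew : inner ℝ e w = 0) :
    ∫⁻ q, g (inner ℝ q e) * ENNReal.ofReal ((inner ℝ q w) ^ 2) ∂μ =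
      ENNReal.ofReal (1 / ((d : ℝ) - 1)) *
        (∫⁻ q, g (inner ℝ q e) * ENNReal.ofReal (‖q‖ ^ 2 - (inner ℝ q e) ^ 2) ∂μ) *
        ENNReal.ofReal (‖w‖ ^ 2) := by
  have : NeZero d := ⟨by omega⟩
  obtain ⟨b, hb⟩ := Orthonormal.exists_orthonormalBasis_extension_of_card_eq
    (𝕜 := ℝ) (E := EuclideanSpace ℝ (Fin d)) (ι := Fin d) (by simp) (v := fun _ => e) (s := {0})
    ⟨fun i => by simpa using he, fun i j hij => (hij (Subsingleton.elim _ _)).elim⟩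
  have hb0 : b 0 = e := hb 0 rfl
  have hterm (i : Fin d) (hi : i ≠ 0) :
      ∫⁻ q, g (inner ℝ q e) * ENNReal.ofReal ((inner ℝ q w) ^ 2) ∂μ =
        (∫⁻ q, g (inner ℝ q e) * ENNReal.ofReal ((inner ℝ q (b i)) ^ 2) ∂μ) *
          ENNReal.ofReal (‖w‖ ^ 2) := by
    have hei : inner ℝ e (b i) = 0 := hb0 ▸ b.orthonormal.2 hi.symm
    obtain ⟨U, hUw, hU⟩ := exists_linearIsometryEquiv_map_eq (v := w) (w := ‖w‖ • b i)
      (by simp [norm_smul])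
    have hUe : U e = e := hU e (by simp [inner_smul_right, hew, hei])
    rw [← lintegral_mul_const' _ _ ENNReal.ofReal_ne_top,
      ← hμ.lintegral_comp U fun q => g (inner ℝ q e) * _ * _]
    refine lintegral_congr fun q => ?_
    have h1 : inner ℝ (U q) e = inner ℝ q e := by
      conv_lhs => rw [← hUe, U.inner_map_map]
    have h2 : inner ℝ q w = inner ℝ (U q) (b i) * ‖w‖ := by
      rw [← U.inner_map_map, hUw, inner_smul_right, mul_comm]
    rw [h1, h2, mul_pow, ENNReal.ofReal_mul (by positivity), mul_assoc]
  -- Sum over the `d - 1` basis vectors other than `e`; by Parseval their squares add up to `‖q‖² -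
  -- ⟨q, e⟩²`.
  have hsum : ((d - 1 : ℕ) : ℝ≥0∞) *
      ∫⁻ q, g (inner ℝ q e) * ENNReal.ofReal ((inner ℝ q w) ^ 2) ∂μ =
      (∫⁻ q, g (inner ℝ q e) * ENNReal.ofReal (‖q‖ ^ 2 - (inner ℝ q e) ^ 2) ∂μ) *
        ENNReal.ofReal (‖w‖ ^ 2) := by
    calc
      _ = ∑ i ∈ Finset.univ.erase (0 : Fin d),
          ∫⁻ q, g (inner ℝ q e) * ENNReal.ofReal ((inner ℝ q w) ^ 2) ∂μ := by
        simp
      _ = ∑ i ∈ Finset.univ.erase (0 : Fin d),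
          (∫⁻ q, g (inner ℝ q e) * ENNReal.ofReal ((inner ℝ q (b i)) ^ 2) ∂μ) *
            ENNReal.ofReal (‖w‖ ^ 2) :=
        Finset.sum_congr rfl fun i hi => hterm i (Finset.ne_of_mem_erase hi)
      _ = _ := by
        rw [← Finset.sum_mul, ← lintegral_finsetSum _ fun i _ => by fun_prop]
        congr 1
        refine lintegral_congr fun q => ?_
        rw [← Finset.mul_sum, ← ENNReal.ofReal_sum_of_nonneg fun i _ => sq_nonneg _,
          ← b.sum_sq_inner_left q, ← Finset.add_sum_erase _ _ (Finset.mem_univ (0 : Fin d)), hb0,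
          add_sub_cancel_left]
  have hpos : 0 < (d : ℝ) - 1 := by
    have : (2 : ℝ) ≤ d := by exact_mod_cast hd
    linarith
  rw [mul_assoc, ← hsum, ← mul_assoc, ← ENNReal.ofReal_natCast, Nat.cast_sub (by omega),
    Nat.cast_one, ← ENNReal.ofReal_mul (by positivity), one_div_mul_cancel hpos.ne',
    ENNReal.ofReal_one, one_mul]

end Components

theorem inner_residualOrthogonal {d : ℕ} {u : EuclideanSpace ℝ (Fin d)} (hu : u ≠ 0)
    (v : EuclideanSpace ℝ (Fin d)) : inner ℝ u (residualOrthogonal u v) = 0 := by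
  have : ‖u‖ ≠ 0 := norm_ne_zero_iff.2 hu
  rw [residualOrthogonal, residualParallel, inner_sub_right, inner_smul_right,
    real_inner_self_eq_norm_sq, real_inner_comm]
  field_simp
  ring

theorem mainTheorem12 (d : ℕ) (hd : 2 ≤ d) :
    ∃ c : ℝ≥0, 0 < c ∧
      ∀ (μ : Measure (EuclideanSpace ℝ (Fin d))), IsProbabilityMeasure μ →
        SphericallySymmetric μ →
        ∀ (ω : ℝ → ℝ≥0), Measurable ω →
        ∀ (u v : EuclideanSpace ℝ (Fin d)), u ≠ 0 →
          -- unit-norm queries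
          ((∀ᵐ q ∂μ, ‖q‖ = 1) →
            scoreAwareLoss μ ω u v =
              c * (hParallel d ω ‖u‖ * ENNReal.ofReal (‖residualParallel u v‖ ^ 2) +
                hOrthogonal d ω ‖u‖ * ENNReal.ofReal (‖residualOrthogonal u v‖ ^ 2))) ∧
          -- queries of arbitrary (random) norm
          scoreAwareLoss μ ω u v =
            c * ((∫⁻ q, ENNReal.ofReal (‖q‖ ^ 2) * hParallel d ω (‖q‖ * ‖u‖) ∂μ) *
                  ENNReal.ofReal (‖residualParallel u v‖ ^ 2) +
                (∫⁻ q, ENNReal.ofReal (‖q‖ ^ 2) * hOrthogonal d ω (‖q‖ * ‖u‖) ∂μ) *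
                  ENNReal.ofReal (‖residualOrthogonal u v‖ ^ 2)) := by
  obtain ⟨n, rfl⟩ := Nat.exists_eq_add_of_le' hd
  obtain ⟨c, hc, H⟩ := exists_lintegral_norm_inner n
  refine ⟨c, hc, fun μ _ hμ ω hω u v hu => ?_⟩
  suffices hgen : scoreAwareLoss μ ω u v =
      c * ((∫⁻ q, ENNReal.ofReal (‖q‖ ^ 2) * hParallel (n + 2) ω (‖q‖ * ‖u‖) ∂μ) *
            ENNReal.ofReal (‖residualParallel u v‖ ^ 2) +
          (∫⁻ q, ENNReal.ofReal (‖q‖ ^ 2) * hOrthogonal (n + 2) ω (‖q‖ * ‖u‖) ∂μ) *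
            ENNReal.ofReal (‖residualOrthogonal u v‖ ^ 2)) by
    refine ⟨fun hq => ?_, hgen⟩
    have h (f : ℝ → ℝ≥0∞) :
        ∫⁻ q, ENNReal.ofReal (‖q‖ ^ 2) * f (‖q‖ * ‖u‖) ∂μ = f ‖u‖ := by
      rw [lintegral_congr_ae (g := fun _ => f ‖u‖) (hq.mono fun q hq => by simp [hq])]
      simp
    rw [hgen, h, h]
  have hu0 : 0 < ‖u‖ := norm_pos_iff.2 hu
  set e := ‖u‖⁻¹ • u with he
  have hue : u = ‖u‖ • e := by rw [he, smul_inv_smul₀ hu0.ne']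
  have he1 : ‖e‖ = 1 := by rw [he, norm_smul, norm_inv, norm_norm, inv_mul_cancel₀ hu0.ne']
  have hqu (q : EuclideanSpace ℝ (Fin (n + 2))) : inner ℝ q u = ‖u‖ * inner ℝ q e := by
    conv_lhs => rw [hue, inner_smul_right]
  have huw : inner ℝ u (residualOrthogonal u v) = 0 := inner_residualOrthogonal hu v
  have hew : inner ℝ e (residualOrthogonal u v) = 0 := by
    rw [he, real_inner_smul_left, huw, mul_zero]
  have hsplit : u - v = residualParallel u v + residualOrthogonal u v :=
    (add_sub_cancel _ _).symm
  have hpar : ∫⁻ q, (ω (inner ℝ q u) : ℝ≥0∞) *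
        ENNReal.ofReal ((inner ℝ q (residualParallel u v)) ^ 2) ∂μ =
      c * (∫⁻ q, ENNReal.ofReal (‖q‖ ^ 2) * hParallel (n + 2) ω (‖q‖ * ‖u‖) ∂μ) *
        ENNReal.ofReal (‖residualParallel u v‖ ^ 2) := by
    calc
      _ = ∫⁻ q, (ω (‖u‖ * inner ℝ q e) : ℝ≥0∞) * ENNReal.ofReal ((inner ℝ q e) ^ 2) *
          ENNReal.ofReal (‖residualParallel u v‖ ^ 2) ∂μ := by
        refine lintegral_congr fun q => ?_
        rw [mul_assoc, ← ENNReal.ofReal_mul (by positivity), residualParallel,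
          inner_smul_right, hqu, norm_smul, mul_pow, mul_pow, mul_pow, Real.norm_eq_abs, sq_abs]
        congr 2
        ring
      _ = _ := by
        rw [lintegral_mul_const' _ _ ENNReal.ofReal_ne_top,
          H μ inferInstance hμ (fun p => (ω (‖u‖ * p.2) : ℝ≥0∞) * ENNReal.ofReal (p.2 ^ 2))
            (by fun_prop) e he1]
        congr 2
        refine lintegral_congr fun q => ?_
        rw [hParallel, ← lintegral_const_mul' _ _ ENNReal.ofReal_ne_top]
        refine setLIntegral_congr_fun measurableSet_Icc fun θ hθ => ?_
        have hs : 0 ≤ Real.sin θ := Real.sin_nonneg_of_mem_Icc hθ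
        dsimp only
        rw [mul_assoc, ← ENNReal.ofReal_mul (by positivity), mul_left_comm (ENNReal.ofReal _),
          ← ENNReal.ofReal_mul (by positivity), Nat.add_sub_cancel]
        congr 2
        · rw [mul_left_comm, mul_assoc]
        -- `cos² θ sin^n θ = sin^n θ - sin^(n+2) θ`.
        · rw [mul_pow, Real.cos_sq']; ring
  have hort : ∫⁻ q, (ω (inner ℝ q u) : ℝ≥0∞) *
        ENNReal.ofReal ((inner ℝ q (residualOrthogonal u v)) ^ 2) ∂μ =
      c * (∫⁻ q, ENNReal.ofReal (‖q‖ ^ 2) * hOrthogonal (n + 2) ω (‖q‖ * ‖u‖) ∂μ) *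
        ENNReal.ofReal (‖residualOrthogonal u v‖ ^ 2) := by
    simp only [hqu]
    rw [hμ.lintegral_inner_orthogonal_sq hd (g := fun t => (ω (‖u‖ * t) : ℝ≥0∞)) (by fun_prop)
        he1 hew,
      H μ inferInstance hμ
        (fun p => (ω (‖u‖ * p.2) : ℝ≥0∞) * ENNReal.ofReal (p.1 ^ 2 - p.2 ^ 2))
        (by fun_prop) e he1, mul_left_comm, ← lintegral_const_mul' _ _ ENNReal.ofReal_ne_top]
    congr 2
    refine lintegral_congr fun q => ?_
    rw [hOrthogonal, mul_left_comm]
    congr 1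
    rw [← lintegral_const_mul' _ _ ENNReal.ofReal_ne_top]
    refine setLIntegral_congr_fun measurableSet_Icc fun θ hθ => ?_
    have hs : 0 ≤ Real.sin θ := Real.sin_nonneg_of_mem_Icc hθ
    dsimp only
    rw [mul_assoc, ← ENNReal.ofReal_mul' (by positivity), mul_left_comm (ENNReal.ofReal _),
      ← ENNReal.ofReal_mul (by positivity)]
    congr 2
    · rw [mul_left_comm, mul_assoc]
    -- `(‖q‖² - ‖q‖² cos² θ) sin^n θ = ‖q‖² sin^(n+2) θ`.
    · rw [mul_pow, Real.cos_sq']; ring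
  rw [mul_add, ← mul_assoc, ← mul_assoc, ← hpar, ← hort, scoreAwareLoss, hsplit]
  exact hμ.lintegral_inner_add_sq hω huw _
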